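/- **Model (ASYNC LOCAL).** Let $G=(V,E)$ be a connected simple graph on $n$ nodes. Each node $v$ receives an identifier $\mathrm{id}(v)\in\{1,\dots,N\}$, pairwise distinct, and has a register $R(v)$, initially empty ($\bot$), written only by $v$ and read only by the neighbors of $v$. A deterministic algorithm consists of a function giving the initial state of a node from its identifier, and a function giving the new state of a non-terminated node from its current state and the contents of its neighbors' registers; there is a special state $\mathrm{term}(x)$ for each output $x$, meaning termination with output $x$, and a node in such a state never changes state again. A scheduling is an arbitrary sequence $S_1,S_2,\dots$ of subsets of $V$. At step $i$, all nodes of $S_i$ simultaneously write their current states in their registers, then they all read the registers of their neighbors and update their states; the other nodes do nothing. The algorithm solves $c$-coloring of $G$ if, for all assignments of pairwise distinct identifiers in $\{1,\dots,N\}$ and all schedulings, every node that is activated infinitely often terminates with an output in a fixed palette of $c$ colors, and any two adjacent nodes that terminate output different colors. The algorithm may depend on $n$, $\Delta$, $N$ (and, in part 1, on $G$), and its number of steps is not restricted. **Statement.** Let $\Delta\ge 2$ be an even number, let $n>\Delta$ be a prime number, and let $N\ge 2n-1$. 1. Let $G$ be the circulant graph with nodes $u_0,\dots,u_{n-1}$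 in which $u_i$ is joined to $u_{i\pm1},\dots,u_{i\pm\Delta/2}$ (indices modulo $n$). No deterministic algorithm in the ASYNC LOCAL model solves $(\Delta+2)$-coloring of $G$ with identifiers in $\{1,\dots,N\}$. 2. Consequently, $(\Delta+2)$-coloring $n$-node $\Delta$-regular graphs cannot be solved deterministically in ASYNC LOCAL: there is no deterministic algorithm that solves $(\Delta+2)$-coloring, with identifiers in $\{1,\dots,N\}$, of all connected $n$-node $\Delta$-regular graphs. -/

import Mathlib

universe u

namespace AsyncLocal

/-- The state of a node: either a running state, or the special state `term x` denoting that the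
node has terminated with output `x`. -/
inductive NodeState (S : Type u) (C : Type) : Type u
  | run (s : S) : NodeState S C
  | term (x : C) : NodeState S C

/-- A deterministic algorithm with outputs in `C`, whose nodes receive their identifier and no
other input. `init` gives the initial state of a node from its identifier. `next` gives the new
state of a node that has not terminated, from its current state and from the contents of the
registers of its neighbors; `none` is the content of a register that was never written. The
functions are arbitrary, so that they may encode any global knowledge such as the number of nodes,
the degree, the range of the identifiers, or the graph up to isomorphism. -/
structure Algorithm (C : Type) where
  State : Type u
  init : ℕ → NodeState State C
  next : State → Multiset (Option (NodeState State C)) → NodeState State C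

/-- A configuration: `old v` is the content of the register of `v` (what its neighbors read),
`new v` is the current state of `v`, to be written the next time that `v` is activated. -/
structure Config (V : Type) (S : Type u) (C : Type) where
  old : V → Option (NodeState S C)
  new : V → NodeState S C

section Execution

variable {V C : Type} [Finite V] [DecidableEq V]

/-- Registers are empty at the beginning, and the state of `v` is computed from its identifier. -/
def Algorithm.start (A : Algorithm.{u} C) (ident : V → ℕ) : Config V A.State C where
  old := fun _ => none
  new := fun v => A.init (ident v)

/-- The registers after the nodes of `T` have simultaneously written their current states. -/
def Config.written {S : Type u} (c : Config V S C) (T : Finset V) :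
    V → Option (NodeState S C) :=
  fun v => if v ∈ T then some (c.new v) else c.old v

/-- The multiset of the contents of the registers of the neighbors of `v` in `G`. -/
noncomputable def neighborView {S : Type u} (G : SimpleGraph V)
    (reg : V → Option (NodeState S C)) (v : V) : Multiset (Option (NodeState S C)) :=
  (G.neighborSet v).toFinite.toFinset.val.map reg

/-- One step, in which exactly the nodes of `T` are activated: all of them write their current
states, then all of them read the registers of their neighbors and update their states. The state
of a terminated node does not change. -/
noncomputable def Algorithm.step (A : Algorithm.{u} C) (G : SimpleGraph V) (T : Finset V)
    (c : Config V A.State C) : Config V A.State C where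
  old := c.written T
  new := fun v =>
    if v ∈ T then
      match c.new v with
      | .run s => A.next s (neighborView G (c.written T) v)
      | .term x => .term x
    else c.new v

/-- The configuration reached after the first `t` steps of the scheduling `sched`, the nodes
activated at step `i` being those of `sched i` (steps are numbered from `0`). -/
noncomputable def Algorithm.exec (A : Algorithm.{u} C) (G : SimpleGraph V) (ident : V → ℕ)
    (sched : ℕ → Finset V) : ℕ → Config V A.State C
  | 0 => A.start ident
  | t + 1 => A.step G (sched t) (A.exec G ident sched t)

/-- In the given execution, node `v` terminates with output `x`. -/
def Algorithm.Outputs (A : Algorithm.{u} C) (G : SimpleGraph V) (ident : V → ℕ)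
    (sched : ℕ → Finset V) (v : V) (x : C) : Prop :=
  ∃ t, (A.exec G ident sched t).new v = .term x

/-- The algorithm `A` solves proper coloring of the graph `G`, with color palette `C`, when the
nodes have pairwise distinct identifiers in `{1, …, N}`: for all identifiers and all schedulings,
every node that does not crash (that is activated infinitely often) terminates, and the outputs of
any two adjacent terminated nodes are distinct. -/
def Algorithm.SolvesColoring (A : Algorithm.{u} C) (G : SimpleGraph V) (N : ℕ) : Prop :=
  ∀ ident : V → ℕ, Function.Injective ident → (∀ v, ident v ∈ Set.Icc 1 N) →
    ∀ sched : ℕ → Finset V,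
      (∀ v, {i | v ∈ sched i}.Infinite → ∃ x, A.Outputs G ident sched v x) ∧
      (∀ v w x y, G.Adj v w → A.Outputs G ident sched v x → A.Outputs G ident sched w y → x ≠ y)

end Execution

/-- The graph on `ℤ/nℤ` in which every node `i` is adjacent to the nodes `i ± 1, …, i ± k`. -/
def ringGraph (n k : ℕ) : SimpleGraph (ZMod n) :=
  SimpleGraph.circulantGraph ((fun j : ℕ => (j : ZMod n)) '' Set.Icc 1 k)

end AsyncLocal

/-! Write Δ = 2k and split the palette into two halves of k+1 colors. In the circulant graph any k+1
consecutive nodes form a clique, so a proper coloring with k+1 colors has period k+1, a unit modulo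
the prime n; it would be constant. Hence every complete execution uses both halves, and it suffices
to show that some execution stays in one half (`exists_monochromatic`).

This is a signed counting argument modulo n. Give each execution the sign ∏ (-1)^(#Bᵢ - 1) over its
activated blocks. For a test function that ignores p, activating p together with B cancels against
activating p and then B, so the signed sum over executions of P restricts to that of any subset S
(`signedSum_eq_of_dependsOn`). Identifiers could break the symmetry, so they are also averaged, by a
signed measure on injective assignments of 2n-1 names, modeled on a recursive renaming algorithm. It
has the same restriction property (`nameMeasure_eq_of_dependsOn`) and, on proper subsets, is
translation invariant (`nameMeasure_map`).

Let T(S) be the resulting signed count of executions in which all of S output in the first half.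
Then T(∅) = 1, and T(univ) = 0 if no execution stays in the first half. By inclusion-exclusion, ∑
(-1)^#S T(S) counts the executions avoiding the first half, so it is 0 as well. But T is translation
invariant, and nonempty proper subsets of ℤ/nℤ have translation orbits of size n, so their
contribution is divisible by n. Therefore n divides 1. -/

/-- Splitting a sum over the nonempty subsets of `P` according to the membership of `p`. -/
theorem sum_nonempty_subsets_eq_add {V M : Type*} [DecidableEq V] [AddCommMonoid M] {P : Finset V}
    {p : V} (hp : p ∈ P) (F : Finset V → M) :
    ∑ B ∈ P.powerset.erase ∅, F B =
      ∑ B ∈ (P.erase p).powerset.erase ∅, F B + ∑ B ∈ (P.erase p).powerset, F (insert p B) := by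
  have h1 : P.powerset.erase ∅ = (P.erase p).powerset.erase ∅ ∪
      (P.erase p).powerset.image (insert p) := by
    conv_lhs => rw [← Finset.insert_erase hp, Finset.powerset_insert]
    ext B
    simp only [Finset.mem_erase, Finset.mem_union, Finset.mem_image, Finset.mem_powerset]
    constructor
    · rintro ⟨h, h' | h'⟩
      · exact Or.inl ⟨h, h'⟩
      · exact Or.inr h'
    · rintro (⟨h, h'⟩ | ⟨B', h, rfl⟩)
      · exact ⟨h, Or.inl h'⟩
      · exact ⟨Finset.insert_ne_empty _ _, Or.inr ⟨B', h, rfl⟩⟩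
  have hnot : ∀ B ∈ (P.erase p).powerset, p ∉ B := fun B hB h =>
    Finset.notMem_erase p P (Finset.mem_powerset.1 hB h)
  rw [h1, Finset.sum_union, Finset.sum_image]
  · intro B hB B' hB' h
    rw [← Finset.erase_insert (hnot B hB), ← Finset.erase_insert (hnot B' hB')]
    exact congrArg (Finset.erase · p) h
  · rw [Finset.disjoint_left]
    intro B hB hB'
    obtain ⟨B', -, rfl⟩ := Finset.mem_image.1 hB'
    exact hnot _ (Finset.mem_of_mem_erase hB) (Finset.mem_insert_self _ _)

/-! ### Signed renaming measure with names below 2#P - 1. -/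

section Renaming

variable {V : Type*} [DecidableEq V]

/-- The signed measure, seen as a functional on test functions `h`, on the assignments of names to
the members of `P`, that counts with signs the executions of the recursive renaming algorithm
based on immediate snapshots. In the term of index `B`, the members of `B` have seen all
of `P`: the one chosen by `m` takes the largest name `2 * #P - 2`, and the other ones are recursively
renamed downwards from `2 * #P - 3`; the members of `P \ B` are renamed upwards from `0`. -/
noncomputable def nameMeasure (m : Finset V → V) (hm : ∀ P : Finset V, P.Nonempty → m P ∈ P)
    (P : Finset V) (h : (V → ℕ) → ℤ) : ℤ :=
  if P = ∅ then h 0 else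
    ∑ B ∈ (P.powerset.erase ∅).attach, (-1) ^ (B.1.card + 1) *
      nameMeasure m hm (P \ B.1) fun f => nameMeasure m hm (B.1.erase (m P)) fun e =>
        h fun v => if v ∈ B.1 then (if v = m P then 2 * P.card - 2 else 2 * P.card - 3 - e v)
          else f v
termination_by P.card
decreasing_by
  all_goals
    have hB := B.2
    rw [Finset.mem_erase, Finset.mem_powerset, ← Finset.nonempty_iff_ne_empty] at hB
    apply Finset.card_lt_card
  · have := hm P (hB.1.mono hB.2)
    refine ⟨(Finset.erase_subset _ _).trans hB.2, fun h => ?_⟩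
    exact Finset.notMem_erase _ _ (h this)
  · exact Finset.sdiff_ssubset hB.2 hB.1

variable {m : Finset V → V} {hm : ∀ P : Finset V, P.Nonempty → m P ∈ P}

theorem nameMeasure_empty (h : (V → ℕ) → ℤ) : nameMeasure m hm ∅ h = h 0 := by
  rw [nameMeasure, if_pos rfl]

theorem nameMeasure_of_nonempty {P : Finset V} (hP : P.Nonempty) (h : (V → ℕ) → ℤ) :
    nameMeasure m hm P h = ∑ B ∈ P.powerset.erase ∅, (-1) ^ (B.card + 1) *
      nameMeasure m hm (P \ B) fun f => nameMeasure m hm (B.erase (m P)) fun e =>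
        h fun v => if v ∈ B then (if v = m P then 2 * P.card - 2 else 2 * P.card - 3 - e v)
          else f v := by
  rw [nameMeasure, if_neg hP.ne_empty]
  exact Finset.sum_attach (P.powerset.erase ∅) fun B => (-1) ^ (B.card + 1) *
      nameMeasure m hm (P \ B) fun f => nameMeasure m hm (B.erase (m P)) fun e =>
        h fun v => if v ∈ B then (if v = m P then 2 * P.card - 2 else 2 * P.card - 3 - e v)
          else f v

theorem card_erase_choice_lt (hm : ∀ P : Finset V, P.Nonempty → m P ∈ P) {P B : Finset V}
    (hP : P.Nonempty) (hB : B ⊆ P) : (B.erase (m P)).card < P.card :=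
  Finset.card_lt_card ⟨(Finset.erase_subset _ _).trans hB,
    fun h => Finset.notMem_erase _ _ (h (hm P hP))⟩

theorem card_sdiff_lt {P B : Finset V} (hB : B.Nonempty) (hBP : B ⊆ P) :
    (P \ B).card < P.card :=
  Finset.card_lt_card (Finset.sdiff_ssubset hBP hB)

/-- `nameMeasure` is supported on the injective assignments of names less than `2 * #P - 1`. -/
theorem nameMeasure_congr (P : Finset V) {h h' : (V → ℕ) → ℤ}
    (hh : ∀ f : V → ℕ, Set.InjOn f P → (∀ v ∈ P, f v + 2 ≤ 2 * P.card) → h f = h' f) :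
    nameMeasure m hm P h = nameMeasure m hm P h' := by
  induction hk : P.card using Nat.strong_induction_on generalizing P h h' with
  | _ k ih =>
  subst hk
  rcases P.eq_empty_or_nonempty with rfl | hP
  · rw [nameMeasure_empty, nameMeasure_empty]
    exact hh 0 (by simp) (by simp)
  rw [nameMeasure_of_nonempty hP, nameMeasure_of_nonempty hP]
  refine Finset.sum_congr rfl fun B hB => ?_
  rw [Finset.mem_erase, Finset.mem_powerset, ← Finset.nonempty_iff_ne_empty] at hB
  obtain ⟨hB, hBP⟩ := hB
  congr 1
  refine ih _ (card_sdiff_lt hB hBP) _ (fun f hf hfle => ?_) rfl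
  refine ih _ (card_erase_choice_lt hm hP hBP) _ (fun e he hele => ?_) rfl
  have hmP := hm P hP
  have hcard : (P \ B).card + B.card = P.card := Finset.card_sdiff_add_card_eq_card hBP
  -- The first bound shows that `2 * P.card - 3 - e v` is not truncated. The second puts it at `2 *
  -- (P \ B).card - 1` or more, just above every name given to `P \ B`.
  have hle : ∀ v ∈ B, v ≠ m P →
      e v + 4 ≤ 2 * P.card ∧ 2 * (P \ B).card + e v + 2 ≤ 2 * P.card := by
    intro v hv hvm
    have h1 := hele v (Finset.mem_erase.2 ⟨hvm, hv⟩)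
    have h2 := card_erase_choice_lt hm hP hBP
    have h3 : (B.erase (m P)).card ≤ B.card := Finset.card_erase_le
    omega
  have hBpos := hB.card_pos
  apply hh
  · intro v hv w hw hvw
    simp only at hvw
    have hfv : v ∉ B → f v + 2 ≤ 2 * (P \ B).card := fun h => hfle v (Finset.mem_sdiff.2 ⟨hv, h⟩)
    have hfw : w ∉ B → f w + 2 ≤ 2 * (P \ B).card := fun h => hfle w (Finset.mem_sdiff.2 ⟨hw, h⟩)
    split_ifs at hvw with hvB hvm hwB hwm hwB hwm hwB hwm
    · rw [hvm, hwm]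
    · have := hle w hwB hwm; omega
    · have := hfw hwB; omega
    · have := hle v hvB hvm; omega
    · have h1 := hle v hvB hvm
      have h2 := hle w hwB hwm
      exact he (Finset.mem_coe.2 (Finset.mem_erase.2 ⟨hvm, hvB⟩))
        (Finset.mem_coe.2 (Finset.mem_erase.2 ⟨hwm, hwB⟩)) (by omega)
    · have := hle v hvB hvm; have := hfw hwB; omega
    · have := hfv hvB; omega
    · have := hle w hwB hwm; have := hfv hvB; omega
    · exact hf (Finset.mem_coe.2 (Finset.mem_sdiff.2 ⟨hv, hvB⟩))
        (Finset.mem_coe.2 (Finset.mem_sdiff.2 ⟨hw, hwB⟩)) hvw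
  · intro v hv
    have hfv : v ∉ B → f v + 2 ≤ 2 * (P \ B).card := fun h => hfle v (Finset.mem_sdiff.2 ⟨hv, h⟩)
    split_ifs with hvB hvm
    · omega
    · have := hle v hvB hvm; omega
    · have := hfv hvB; omega

theorem nameMeasure_sum {ι : Type*} (s : Finset ι) (a : ι → ℤ) (P : Finset V)
    (h : ι → (V → ℕ) → ℤ) :
    nameMeasure m hm P (fun f => ∑ i ∈ s, a i * h i f) = ∑ i ∈ s, a i * nameMeasure m hm P (h i) := by
  induction hk : P.card using Nat.strong_induction_on generalizing P h with
  | _ k ih =>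
  subst hk
  rcases P.eq_empty_or_nonempty with rfl | hP
  · simp only [nameMeasure_empty]
  simp only [nameMeasure_of_nonempty hP, Finset.mul_sum]
  rw [Finset.sum_comm]
  refine Finset.sum_congr rfl fun B hB => ?_
  rw [Finset.mem_erase, Finset.mem_powerset, ← Finset.nonempty_iff_ne_empty] at hB
  obtain ⟨hB, hBP⟩ := hB
  simp only [ih _ (card_erase_choice_lt hm hP hBP) _ _ rfl, ih _ (card_sdiff_lt hB hBP) _ _ rfl,
    Finset.mul_sum]
  refine Finset.sum_congr rfl fun i _ => ?_
  ring

/-- The marginals of the renaming measure are renaming measures. -/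
theorem nameMeasure_erase {P : Finset V} {p : V} (hp : p ∈ P) {h : (V → ℕ) → ℤ}
    (hh : DependsOn h {p}ᶜ) : nameMeasure m hm P h = nameMeasure m hm (P.erase p) h := by
  induction hk : P.card using Nat.strong_induction_on generalizing P p h with
  | _ k ih =>
  subst hk
  have hP : P.Nonempty := ⟨p, hp⟩
  -- For `B` avoiding `p`, the terms of index `B` and `insert p B` both reduce to `t B`, with
  -- opposite signs. Only the index `{p}`, whose partner would be the empty set, survives; it
  -- contributes `t ∅`.
  let t : Finset V → ℤ := fun B => nameMeasure m hm (P.erase p \ B) fun f =>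
    nameMeasure m hm (B.erase (m P)) fun e =>
      h fun v => if v ∈ B then (if v = m P then 2 * P.card - 2 else 2 * P.card - 3 - e v)
        else f v
  have h1 : ∀ B ∈ (P.erase p).powerset.erase ∅, (-1) ^ (B.card + 1) *
      (nameMeasure m hm (P \ B) fun f => nameMeasure m hm (B.erase (m P)) fun e =>
        h fun v => if v ∈ B then (if v = m P then 2 * P.card - 2 else 2 * P.card - 3 - e v)
          else f v) = - ((-1) ^ B.card * t B) := by
    intro B hB
    rw [Finset.mem_erase, Finset.mem_powerset, ← Finset.nonempty_iff_ne_empty] at hB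
    obtain ⟨hB, hBP⟩ := hB
    have hpB : p ∉ B := fun h => Finset.notMem_erase _ _ (hBP h)
    rw [ih _ (card_sdiff_lt hB (hBP.trans (Finset.erase_subset _ _)))
      (Finset.mem_sdiff.2 ⟨hp, hpB⟩) (fun f f' hff => ?_) rfl, ← Finset.erase_sdiff_comm, pow_succ]
    · ring
    · refine congrArg _ (funext fun e => hh fun v hv => ?_)
      rw [hff v hv]
  have h2 : ∀ B ∈ (P.erase p).powerset, (-1) ^ ((insert p B).card + 1) *
      (nameMeasure m hm (P \ insert p B) fun f => nameMeasure m hm ((insert p B).erase (m P)) fun e =>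
        h fun v => if v ∈ insert p B then
          (if v = m P then 2 * P.card - 2 else 2 * P.card - 3 - e v) else f v) =
      (-1) ^ B.card * t B := by
    intro B hB
    rw [Finset.mem_powerset] at hB
    have hpB : p ∉ B := fun h => Finset.notMem_erase _ _ (hB h)
    have hset : P \ insert p B = P.erase p \ B := by
      rw [Finset.erase_sdiff_comm, Finset.sdiff_insert]
    rw [Finset.card_insert_of_notMem hpB, hset, pow_succ, pow_succ, mul_assoc _ (-1 : ℤ) (-1)]
    norm_num only [mul_one]
    congr 1
    refine congrArg _ (funext fun f => ?_)
    have hfun : ∀ e : V → ℕ,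
        (h fun v => if v ∈ insert p B then
          (if v = m P then 2 * P.card - 2 else 2 * P.card - 3 - e v) else f v) =
        h fun v => if v ∈ B then
          (if v = m P then 2 * P.card - 2 else 2 * P.card - 3 - e v) else f v := fun e =>
      hh fun v hv => by simp only [Finset.mem_insert, show v ≠ p from hv, false_or]
    simp only [hfun]
    -- If `p` is the chosen node, it holds the top name and is absent from the inner recursion, and
    -- no other node of `B` is the chosen one. Otherwise the inner recursion forgets `p` by
    -- induction.
    by_cases hpm : p = m P
    · rw [← hpm, Finset.erase_insert hpB, Finset.erase_eq_of_notMem hpB]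
    · have hins : insert p B ⊆ P :=
        Finset.insert_subset hp (hB.trans (Finset.erase_subset _ _))
      rw [ih _ (card_erase_choice_lt hm hP hins)
        (Finset.mem_erase.2 ⟨hpm, Finset.mem_insert_self _ _⟩) (fun e e' hee => ?_) rfl,
        Finset.erase_right_comm, Finset.erase_insert hpB]
      refine hh fun v hv => ?_
      rw [hee v hv]
  rw [nameMeasure_of_nonempty hP, sum_nonempty_subsets_eq_add hp, Finset.sum_congr rfl h1,
    Finset.sum_congr rfl h2, Finset.sum_neg_distrib,
    ← Finset.add_sum_erase _ _ (Finset.empty_mem_powerset (P.erase p))]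
  simp [t, nameMeasure_empty]

theorem nameMeasure_eq_of_dependsOn {P S : Finset V} (hS : S ⊆ P) {h : (V → ℕ) → ℤ}
    (hh : DependsOn h S) : nameMeasure m hm P h = nameMeasure m hm S h := by
  induction hk : (P \ S).card generalizing P with
  | zero =>
    rw [Finset.card_eq_zero, Finset.sdiff_eq_empty_iff_subset] at hk
    rw [hS.antisymm hk]
  | succ k ih =>
    obtain ⟨p, hp⟩ : (P \ S).Nonempty := by rw [← Finset.card_pos]; omega
    obtain ⟨hpP, hpS⟩ := Finset.mem_sdiff.1 hp
    rw [nameMeasure_erase hpP (hh.mono fun v hv hvp => hpS (hvp ▸ hv))]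
    refine ih (Finset.subset_erase.2 ⟨hS, hpS⟩) ?_
    rw [Finset.erase_sdiff_comm, Finset.card_erase_of_mem hp, hk]
    rfl

/-- If the choice function `m` commutes with a permutation on proper subsets, then so does the
renaming measure. -/
theorem nameMeasure_map [Fintype V] (σ : Equiv.Perm V)
    (hσ : ∀ P : Finset V, P.Nonempty → P ≠ Finset.univ → m (P.map σ.toEmbedding) = σ (m P))
    {P : Finset V} (hP : P ≠ Finset.univ) (h : (V → ℕ) → ℤ) :
    nameMeasure m hm (P.map σ.toEmbedding) h = nameMeasure m hm P fun f => h (f ∘ σ.symm) := by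
  induction hk : P.card using Nat.strong_induction_on generalizing P h with
  | _ k ih =>
  subst hk
  rcases P.eq_empty_or_nonempty with rfl | hP0
  · rw [Finset.map_empty, nameMeasure_empty, nameMeasure_empty]
    rfl
  have hne : ∀ Q ⊆ P, Q ≠ Finset.univ := fun Q hQ hQ' =>
    hP (Finset.univ_subset_iff.1 (hQ' ▸ hQ))
  rw [nameMeasure_of_nonempty hP0, nameMeasure_of_nonempty (hP0.map)]
  symm
  refine Finset.sum_bij (fun B _ => B.map σ.toEmbedding) ?_ ?_ ?_ ?_
  · intro B hB
    simpa [Finset.map_subset_map] using hB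
  · intro B _ B' _ h
    exact Finset.map_injective _ h
  · intro B hB
    refine ⟨B.map σ.symm.toEmbedding, ?_, ?_⟩
    · simp only [Finset.mem_erase, Finset.mem_powerset] at hB ⊢
      refine ⟨by simpa using hB.1, ?_⟩
      intro v hv
      obtain ⟨w, hw, rfl⟩ := Finset.mem_map.1 hv
      obtain ⟨z, hz, rfl⟩ := Finset.mem_map.1 (hB.2 hw)
      simpa using hz
    · ext v
      simp
  · intro B hB
    rw [Finset.mem_erase, Finset.mem_powerset, ← Finset.nonempty_iff_ne_empty] at hB
    obtain ⟨hB, hBP⟩ := hB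
    have hsd : P.map σ.toEmbedding \ B.map σ.toEmbedding = (P \ B).map σ.toEmbedding := by
      rw [Finset.map_sdiff]
    have her : (B.map σ.toEmbedding).erase (σ (m P)) = (B.erase (m P)).map σ.toEmbedding := by
      rw [Finset.map_erase]; rfl
    rw [hσ P hP0 hP, hsd, her, Finset.card_map, Finset.card_map,
      ih _ (card_sdiff_lt hB hBP) (hne _ Finset.sdiff_subset) _ rfl]
    congr 1
    refine congrArg _ (funext fun f => ?_)
    rw [ih _ (card_erase_choice_lt hm hP0 hBP)
      (hne _ ((Finset.erase_subset _ _).trans hBP)) _ rfl]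
    refine congrArg _ (funext fun e => congrArg h (funext fun v => ?_))
    simp only [Function.comp, Finset.mem_map_equiv, Equiv.symm_apply_eq]

end Renaming

/-! ### Signed count of the executions of a coloring algorithm. -/

namespace AsyncLocal

/-- The nodes of `P` that have not terminated. -/
noncomputable def Config.running {V C : Type} {S : Type u} (c : Config V S C) (P : Finset V) :
    Finset V := by
  classical exact P.filter fun v => ∃ s, c.new v = .run s

theorem Config.mem_running {V C : Type} {S : Type u} {c : Config V S C} {P : Finset V} {v : V} :
    v ∈ c.running P ↔ v ∈ P ∧ ∃ s, c.new v = .run s := by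
  simp [Config.running]

theorem Config.running_subset {V C : Type} {S : Type u} (c : Config V S C) (P : Finset V) :
    c.running P ⊆ P := fun _ hv => (Config.mem_running.1 hv).1

theorem Config.running_congr {V C : Type} {S : Type u} {c c' : Config V S C} {P : Finset V}
    (h : ∀ v ∈ P, c.new v = c'.new v) : c.running P = c'.running P := by
  ext v
  rw [Config.mem_running, Config.mem_running]
  exact and_congr_right fun hv => by rw [h v hv]

theorem Config.running_erase {V C : Type} [DecidableEq V] {S : Type u} (c : Config V S C)
    (P : Finset V) (p : V) : c.running (P.erase p) = (c.running P).erase p := by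
  ext v
  simp [Config.mem_running, and_assoc]

section Execution

variable {V C : Type} [Finite V] [DecidableEq V]

theorem Algorithm.step_new (A : Algorithm.{u} C) (G : SimpleGraph V) (T : Finset V)
    (c : Config V A.State C) (v : V) : (A.step G T c).new v = if v ∈ T then
      match c.new v with
      | .run s => A.next s (neighborView G (c.written T) v)
      | .term x => .term x
    else c.new v := rfl

theorem Algorithm.step_empty (A : Algorithm.{u} C) (G : SimpleGraph V)
    (c : Config V A.State C) : A.step G ∅ c = c := by
  have h : c.written ∅ = c.old := by
    funext v
    simp [Config.written]
  simp [Algorithm.step, h]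

theorem Algorithm.exec_congr (A : Algorithm.{u} C) (G : SimpleGraph V) (ident : V → ℕ)
    {sched sched' : ℕ → Finset V} {t : ℕ} (h : ∀ i < t, sched i = sched' i) :
    A.exec G ident sched t = A.exec G ident sched' t := by
  induction t with
  | zero => rfl
  | succ t ih =>
    rw [Algorithm.exec, Algorithm.exec, h t t.lt_succ_self,
      ih fun i hi => h i (hi.trans t.lt_succ_self)]

theorem Algorithm.exec_new_of_le (A : Algorithm.{u} C) (G : SimpleGraph V) (ident : V → ℕ)
    (sched : ℕ → Finset V) {v : V} {x : C} {s t : ℕ} (hst : s ≤ t)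
    (h : (A.exec G ident sched s).new v = .term x) :
    (A.exec G ident sched t).new v = .term x := by
  induction t, hst using Nat.le_induction with
  | base => exact h
  | succ t _ ih => simp [Algorithm.exec, Algorithm.step, ih]

/-- The configurations that can be reached with distinct identifiers in `{1, …, N}`. -/
abbrev Algorithm.Reachable (A : Algorithm.{u} C) (G : SimpleGraph V) (N : ℕ) :=
  {c : Config V A.State C // ∃ ident : V → ℕ, Function.Injective ident ∧
    (∀ v, ident v ∈ Set.Icc 1 N) ∧ ∃ sched t, A.exec G ident sched t = c}

variable {A : Algorithm.{u} C} {G : SimpleGraph V} {N : ℕ}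

/-- The initial configuration, as a reachable configuration. -/
def Algorithm.Reachable.start (A : Algorithm.{u} C) (G : SimpleGraph V) {N : ℕ} {ident : V → ℕ}
    (h : Function.Injective ident ∧ ∀ v, ident v ∈ Set.Icc 1 N) : A.Reachable G N :=
  ⟨A.start ident, ident, h.1, h.2, fun _ => ∅, 0, rfl⟩

/-- The reachable configuration obtained by activating the nodes of `T`. -/
noncomputable def Algorithm.Reachable.step (x : A.Reachable G N) (T : Finset V) :
    A.Reachable G N :=
  ⟨A.step G T x.1, by
    obtain ⟨ident, hinj, hid, sched, t, hx⟩ := x.2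
    refine ⟨ident, hinj, hid, fun i => if i < t then sched i else T, t + 1, ?_⟩
    rw [Algorithm.exec, ← hx, if_neg (lt_irrefl t),
      A.exec_congr G ident (sched' := sched) fun i hi => if_pos hi]⟩

/-- One step in which only nodes that have not terminated are activated. -/
def Algorithm.Reachable.Next (y x : A.Reachable G N) : Prop :=
  ∃ B : Finset V, B.Nonempty ∧ (∀ v ∈ B, ∃ s, x.1.new v = .run s) ∧ y = x.step B

/-- If `A` solves coloring, then only finitely many steps of nodes that have not terminated can be
made. -/
theorem Algorithm.SolvesColoring.wellFounded (hA : A.SolvesColoring G N) :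
    WellFounded (Algorithm.Reachable.Next (A := A) (G := G) (N := N)) := by
  rw [wellFounded_iff_isEmpty_descending_chain]
  refine ⟨fun ⟨x, hx⟩ => ?_⟩
  choose B hB hrun hstep using hx
  obtain ⟨ident, hinj, hid, sched, t, hx0⟩ := (x 0).2
  -- An infinite chain, preceded by a schedule reaching its first term, is itself a schedule. Some
  -- node is activated infinitely often in it without terminating.
  let sched' : ℕ → Finset V := fun i => if i < t then sched i else B (i - t)
  have hexec : ∀ i, A.exec G ident sched' (t + i) = (x i).1 := by
    intro i
    induction i with
    | zero =>
      rw [← hx0]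
      exact A.exec_congr G ident fun i hi => if_pos hi
    | succ i ih =>
      rw [← add_assoc, Algorithm.exec, ih, hstep i]
      simp [sched', Algorithm.Reachable.step]
  obtain ⟨v, hv⟩ : ∃ v, {i | v ∈ B i}.Infinite := by
    by_contra! hfin
    have hU : (⋃ v, {i | v ∈ B i}).Finite := Set.finite_iUnion hfin
    refine Set.infinite_univ (hU.subset fun i _ => ?_)
    obtain ⟨v, hv⟩ := hB i
    exact Set.mem_iUnion.2 ⟨v, hv⟩
  have hinf : {i | v ∈ sched' i}.Infinite := by
    refine (hv.image (f := fun i => t + i) (add_right_injective t).injOn).mono ?_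
    rintro _ ⟨i, hi, rfl⟩
    simpa [sched'] using hi
  obtain ⟨c, s, hs⟩ := (hA ident hinj hid sched').1 v hinf
  obtain ⟨i, hi, hsi⟩ := hv.exists_gt s
  obtain ⟨r, hr⟩ := hrun i v hi
  have := A.exec_new_of_le G ident sched' (show s ≤ t + i by omega) hs
  rw [hexec, hr] at this
  cases this

/-- The sum of the values of `φ` on the outputs of all the executions from `x` in which the nodes
of `P` are activated until they terminate, where an execution in which sets `B₁, B₂, …` are
successively activated has the sign `∏ (-1) ^ (#Bᵢ - 1)`. -/
noncomputable def Algorithm.SolvesColoring.signedSum (hA : A.SolvesColoring G N) (P : Finset V)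
    (φ : (V → NodeState A.State C) → ℤ) : A.Reachable G N → ℤ :=
  hA.wellFounded.fix fun x ih =>
    if x.1.running P = ∅ then φ x.1.new else
      ∑ B ∈ ((x.1.running P).powerset.erase ∅).attach, (-1) ^ (B.1.card + 1) *
        ih (x.step B.1) ⟨B.1, by
          have hB := B.2
          rw [Finset.mem_erase, Finset.mem_powerset, ← Finset.nonempty_iff_ne_empty] at hB
          exact ⟨hB.1, fun v hv => (Config.mem_running.1 (hB.2 hv)).2, rfl⟩⟩

namespace Algorithm.SolvesColoring

variable (hA : A.SolvesColoring G N)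

theorem signedSum_of_eq_empty {P : Finset V} (φ : (V → NodeState A.State C) → ℤ)
    {x : A.Reachable G N} (hx : x.1.running P = ∅) : hA.signedSum P φ x = φ x.1.new := by
  rw [signedSum, WellFounded.fix_eq, if_pos hx]

theorem signedSum_of_ne_empty {P : Finset V} (φ : (V → NodeState A.State C) → ℤ)
    {x : A.Reachable G N} (hx : x.1.running P ≠ ∅) : hA.signedSum P φ x =
      ∑ B ∈ (x.1.running P).powerset.erase ∅, (-1) ^ (B.card + 1) *
        hA.signedSum P φ (x.step B) := by
  rw [signedSum, WellFounded.fix_eq, if_neg hx]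
  exact Finset.sum_attach ((x.1.running P).powerset.erase ∅) fun B => (-1) ^ (B.card + 1) *
    hA.signedSum P φ (x.step B)

include hA in
/-- Induction on the executions of the nodes of `P`. -/
theorem running_induction (P : Finset V) {p : A.Reachable G N → Prop}
    (ind : ∀ x, (∀ B : Finset V, B.Nonempty → B ⊆ x.1.running P → p (x.step B)) → p x)
    (x : A.Reachable G N) : p x :=
  hA.wellFounded.induction x fun x ih => ind x fun B hB hBP =>
    ih _ ⟨B, hB, fun _ hv => (Config.mem_running.1 (hBP hv)).2, rfl⟩

theorem signedSum_congr (P : Finset V) {φ ψ : (V → NodeState A.State C) → ℤ}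
    (h : ∀ x : A.Reachable G N, x.1.running P = ∅ → φ x.1.new = ψ x.1.new)
    (x : A.Reachable G N) : hA.signedSum P φ x = hA.signedSum P ψ x := by
  induction x using hA.running_induction P with
  | ind x ih =>
  by_cases hx : x.1.running P = ∅
  · rw [hA.signedSum_of_eq_empty φ hx, hA.signedSum_of_eq_empty ψ hx, h x hx]
  rw [hA.signedSum_of_ne_empty φ hx, hA.signedSum_of_ne_empty ψ hx]
  refine Finset.sum_congr rfl fun B hB => ?_
  rw [Finset.mem_erase, Finset.mem_powerset, ← Finset.nonempty_iff_ne_empty] at hB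
  rw [ih B hB.1 hB.2]

theorem signedSum_sum {ι : Type*} (s : Finset ι) (a : ι → ℤ) (P : Finset V)
    (φ : ι → (V → NodeState A.State C) → ℤ) (x : A.Reachable G N) :
    hA.signedSum P (fun f => ∑ i ∈ s, a i * φ i f) x =
      ∑ i ∈ s, a i * hA.signedSum P (φ i) x := by
  induction x using hA.running_induction P with
  | ind x ih =>
  by_cases hx : x.1.running P = ∅
  · simp only [hA.signedSum_of_eq_empty _ hx]
  simp only [hA.signedSum_of_ne_empty _ hx, Finset.mul_sum]
  rw [Finset.sum_comm]
  refine Finset.sum_congr rfl fun B hB => ?_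
  rw [Finset.mem_erase, Finset.mem_powerset, ← Finset.nonempty_iff_ne_empty] at hB
  rw [ih B hB.1 hB.2, Finset.mul_sum]
  refine Finset.sum_congr rfl fun i _ => ?_
  ring

/-- The executions of the nodes of `P` are determined by the registers and by the states of the
nodes of `P`. -/
theorem signedSum_eq_of_agree {P : Finset V} {φ : (V → NodeState A.State C) → ℤ}
    (hφ : DependsOn φ P) (x y : A.Reachable G N) (hold : x.1.old = y.1.old)
    (hnew : ∀ v ∈ P, x.1.new v = y.1.new v) :
    hA.signedSum P φ x = hA.signedSum P φ y := by
  induction x using hA.running_induction P generalizing y with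
  | ind x ih =>
  have hrun := Config.running_congr hnew
  by_cases hx : x.1.running P = ∅
  · rw [hA.signedSum_of_eq_empty φ hx, hA.signedSum_of_eq_empty φ (hrun ▸ hx)]
    exact hφ hnew
  rw [hA.signedSum_of_ne_empty φ hx, hA.signedSum_of_ne_empty φ (hrun ▸ hx), ← hrun]
  refine Finset.sum_congr rfl fun B hB => ?_
  rw [Finset.mem_erase, Finset.mem_powerset, ← Finset.nonempty_iff_ne_empty] at hB
  -- Only nodes of `P` write from now on, so the states of the other nodes never reach a register.
  have hw : x.1.written B = y.1.written B := by
    funext v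
    simp only [Config.written, hold]
    split_ifs with hv
    · rw [hnew v (Config.running_subset _ _ (hB.2 hv))]
    · rfl
  rw [ih B hB.1 hB.2 (y.step B) hw]
  intro v hv
  simp only [Reachable.step, Algorithm.step, hw, hnew v hv]

/-- The marginals of the signed measure on the outputs of the nodes of `P` are the signed measures
on the outputs of subsets of `P`. -/
theorem signedSum_erase {P : Finset V} {p : V} (hp : p ∈ P)
    {φ : (V → NodeState A.State C) → ℤ} (hφ : DependsOn φ (P.erase p)) (x : A.Reachable G N) :
    hA.signedSum P φ x = hA.signedSum (P.erase p) φ x := by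
  induction x using hA.running_induction P with
  | ind x ih =>
  by_cases hpx : p ∈ x.1.running P
  swap
  · have hrun : x.1.running (P.erase p) = x.1.running P := by
      rw [Config.running_erase, Finset.erase_eq_of_notMem hpx]
    by_cases hx : x.1.running P = ∅
    · rw [hA.signedSum_of_eq_empty φ hx, hA.signedSum_of_eq_empty φ (hrun ▸ hx)]
    rw [hA.signedSum_of_ne_empty φ hx, hA.signedSum_of_ne_empty φ (hrun ▸ hx), hrun]
    refine Finset.sum_congr rfl fun B hB => ?_
    rw [Finset.mem_erase, Finset.mem_powerset, ← Finset.nonempty_iff_ne_empty] at hB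
    rw [ih B hB.1 hB.2]
  set U := x.1.running (P.erase p) with hU
  have hUe : (x.1.running P).erase p = U := (Config.running_erase _ _ _).symm
  have hpU : p ∉ U := fun h => Finset.notMem_erase p P (Config.running_subset _ _ h)
  have hUP : U ⊆ x.1.running P := hUe ▸ Finset.erase_subset _ _
  have hUp : (x.step {p}).1.running (P.erase p) = U := by
    refine Config.running_congr fun v hv => ?_
    simp [Reachable.step, Algorithm.step, Finset.ne_of_mem_erase hv]
  rw [hA.signedSum_of_ne_empty φ (Finset.ne_empty_of_mem hpx), sum_nonempty_subsets_eq_add hpx,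
    hUe]
  have h1 : ∀ B ∈ U.powerset.erase ∅, (-1) ^ (B.card + 1) * hA.signedSum P φ (x.step B) =
      (-1) ^ (B.card + 1) * hA.signedSum (P.erase p) φ (x.step B) := by
    intro B hB
    rw [Finset.mem_erase, Finset.mem_powerset, ← Finset.nonempty_iff_ne_empty] at hB
    rw [ih B hB.1 (hB.2.trans hUP)]
  -- Activating `p` with `B`, or `p` and then `B`, leaves the same registers and the same states
  -- outside `p`: in both cases the nodes of `B` read what `p` wrote before its update.
  have h2 : ∀ B ∈ U.powerset, (-1) ^ ((insert p B).card + 1) *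
      hA.signedSum P φ (x.step (insert p B)) =
      (-1) ^ B.card * hA.signedSum (P.erase p) φ ((x.step {p}).step B) := by
    intro B hB
    rw [Finset.mem_powerset] at hB
    have hpB : p ∉ B := fun h => hpU (hB h)
    have hw : (x.step (insert p B)).1.old = ((x.step {p}).step B).1.old := by
      funext v
      simp only [Reachable.step, Algorithm.step, Config.written, Finset.mem_insert,
        Finset.mem_singleton]
      by_cases hvp : v = p
      · subst hvp; simp [hpB]
      · simp [hvp]
    rw [Finset.card_insert_of_notMem hpB, pow_succ, pow_succ, mul_assoc _ (-1 : ℤ) (-1)]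
    norm_num only [mul_one]
    rw [ih _ (Finset.insert_nonempty _ _) (Finset.insert_subset hpx (hB.trans hUP)),
      hA.signedSum_eq_of_agree hφ (x.step (insert p B)) ((x.step {p}).step B) hw]
    intro v hv
    have hvp := Finset.ne_of_mem_erase hv
    replace hw : x.1.written (insert p B) = (A.step G {p} x.1).written B := hw
    change (A.step G (insert p B) x.1).new v = (A.step G B (A.step G {p} x.1)).new v
    have hv' : (A.step G {p} x.1).new v = x.1.new v := by simp [Algorithm.step, hvp]
    rw [Algorithm.step_new, Algorithm.step_new, hw, hv']
    simp only [Finset.mem_insert, hvp, false_or]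
  -- The term `B = ∅` of `h2` is the signed sum after `p` moves alone. Expanded over the next block,
  -- it cancels the other terms of `h2`, and `h1` leaves the signed sum from `x` without `p`. If `U`
  -- is empty there is no next block, and only the first move of `p` matters.
  rw [Finset.sum_congr rfl h1, Finset.sum_congr rfl h2,
    ← Finset.add_sum_erase _ _ (Finset.empty_mem_powerset U)]
  have hemp : (x.step {p}).step ∅ = x.step {p} := by
    exact Subtype.ext (Algorithm.step_empty A G _)
  by_cases hU0 : U = ∅
  · have hpp : hA.signedSum (P.erase p) φ (x.step {p}) = hA.signedSum (P.erase p) φ x := by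
      rw [hA.signedSum_of_eq_empty φ (hUp.trans hU0), hA.signedSum_of_eq_empty φ (hU ▸ hU0)]
      refine hφ fun v hv => ?_
      simp [Reachable.step, Algorithm.step, Finset.ne_of_mem_erase (Finset.mem_coe.1 hv)]
    simp [hU0, hemp, hpp]
  · have hp2 := hA.signedSum_of_ne_empty φ (P := P.erase p) (x := x.step {p}) (hUp.symm ▸ hU0)
    rw [hUp] at hp2
    rw [hA.signedSum_of_ne_empty φ (P := P.erase p) (x := x) (hU ▸ hU0), ← hU, hemp, hp2]
    simp only [pow_succ, Finset.card_empty, pow_zero, one_mul, mul_neg, mul_one, neg_mul,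
      Finset.sum_neg_distrib]
    ring

theorem signedSum_eq_of_dependsOn {P S : Finset V} (hS : S ⊆ P)
    {φ : (V → NodeState A.State C) → ℤ} (hφ : DependsOn φ S) (x : A.Reachable G N) :
    hA.signedSum P φ x = hA.signedSum S φ x := by
  induction hk : (P \ S).card generalizing P with
  | zero =>
    rw [Finset.card_eq_zero, Finset.sdiff_eq_empty_iff_subset] at hk
    rw [hS.antisymm hk]
  | succ k ih =>
    obtain ⟨p, hp⟩ : (P \ S).Nonempty := by rw [← Finset.card_pos]; omega
    obtain ⟨hpP, hpS⟩ := Finset.mem_sdiff.1 hp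
    have hSp : S ⊆ P.erase p := Finset.subset_erase.2 ⟨hS, hpS⟩
    rw [hA.signedSum_erase hpP (hφ.mono (Finset.coe_subset.2 hSp))]
    refine ih hSp ?_
    rw [Finset.erase_sdiff_comm, Finset.card_erase_of_mem hp, hk]
    rfl

/-- Automorphisms of the graph preserve the signed measures on the outputs. -/
theorem signedSum_map (σ : G ≃g G) (P : Finset V) (φ : (V → NodeState A.State C) → ℤ)
    (x y : A.Reachable G N) (hold : ∀ v, y.1.old (σ v) = x.1.old v)
    (hnew : ∀ v, y.1.new (σ v) = x.1.new v) :
    hA.signedSum (P.map σ.toEquiv.toEmbedding) φ y =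
      hA.signedSum P (fun f => φ (f ∘ σ.symm)) x := by
  induction x using hA.running_induction P generalizing y with
  | ind x ih =>
  have hrun : y.1.running (P.map σ.toEquiv.toEmbedding) =
      (x.1.running P).map σ.toEquiv.toEmbedding := by
    ext v
    obtain ⟨v, rfl⟩ := σ.surjective v
    have hmem : ∀ Q : Finset V, σ v ∈ Q.map σ.toEquiv.toEmbedding ↔ v ∈ Q := fun Q =>
      Finset.mem_map' σ.toEquiv.toEmbedding
    rw [Config.mem_running, hmem, hmem, Config.mem_running, hnew]
  have hnew' : y.1.new = x.1.new ∘ σ.symm := by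
    funext v
    simp [← hnew]
  by_cases hx : x.1.running P = ∅
  · rw [hA.signedSum_of_eq_empty _ hx, hA.signedSum_of_eq_empty φ (by rw [hrun, hx]; rfl), hnew']
  rw [hA.signedSum_of_ne_empty _ hx, hA.signedSum_of_ne_empty φ (by rw [hrun]; simpa using hx),
    hrun]
  symm
  refine Finset.sum_bij (fun B _ => B.map σ.toEquiv.toEmbedding) ?_ ?_ ?_ ?_
  · intro B hB
    simpa [Finset.map_subset_map] using hB
  · intro B _ B' _ h
    exact Finset.map_injective _ h
  · intro B hB
    refine ⟨B.map σ.symm.toEquiv.toEmbedding, ?_, ?_⟩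
    · simp only [Finset.mem_erase, Finset.mem_powerset] at hB ⊢
      refine ⟨by simpa using hB.1, ?_⟩
      intro v hv
      obtain ⟨w, hw, rfl⟩ := Finset.mem_map.1 hv
      obtain ⟨z, hz, rfl⟩ := Finset.mem_map.1 (hB.2 hw)
      simpa using hz
    · ext v
      simp only [Finset.mem_map_equiv]
      exact iff_of_eq (congrArg (· ∈ B) (σ.apply_symm_apply v))
  · intro B hB
    rw [Finset.mem_erase, Finset.mem_powerset, ← Finset.nonempty_iff_ne_empty] at hB
    have hmem : ∀ v, σ v ∈ B.map σ.toEquiv.toEmbedding ↔ v ∈ B := fun v =>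
      Finset.mem_map' σ.toEquiv.toEmbedding
    have hw : ∀ v, y.1.written (B.map σ.toEquiv.toEmbedding) (σ v) = x.1.written B v := by
      intro v
      simp only [Config.written, hmem, hnew, hold]
    -- A node sees an unordered multiset of registers, so it cannot detect the relabeling by `σ`.
    have hview : ∀ v, neighborView G (y.1.written (B.map σ.toEquiv.toEmbedding)) (σ v) =
        neighborView G (x.1.written B) v := by
      intro v
      have hset : (G.neighborSet (σ v)).toFinite.toFinset =
          (G.neighborSet v).toFinite.toFinset.map σ.toEquiv.toEmbedding := by
        ext w
        obtain ⟨w, rfl⟩ := σ.surjective w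
        have : σ w ∈ (G.neighborSet v).toFinite.toFinset.map σ.toEquiv.toEmbedding ↔
          w ∈ (G.neighborSet v).toFinite.toFinset := Finset.mem_map' σ.toEquiv.toEmbedding
        rw [this]
        simp [σ.map_adj_iff]
      rw [neighborView, neighborView, hset, Finset.map_val, Multiset.map_map]
      exact Multiset.map_congr rfl fun w _ => hw w
    rw [Finset.card_map, ih B hB.1 hB.2 (y.step (B.map σ.toEquiv.toEmbedding)) hw]
    intro v
    simp only [Reachable.step, Algorithm.step, hmem, hview, hnew]

end Algorithm.SolvesColoring

end Execution

end AsyncLocal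

/-! ### Translations of subsets of ℤ/nℤ, for n prime. -/

section Translation

variable {n : ℕ} [Fact n.Prime]

/-- The barycenter of a set of residues modulo `n`. -/
noncomputable def barycenter (P : Finset (ZMod n)) : ZMod n := (P.card : ZMod n)⁻¹ * ∑ v ∈ P, v

theorem card_cast_ne_zero {P : Finset (ZMod n)} (hP : P.Nonempty) (hP' : P ≠ Finset.univ) :
    (P.card : ZMod n) ≠ 0 := by
  rw [Ne, ZMod.natCast_eq_zero_iff]
  intro h
  have h1 : P.card < n := by
    have := Finset.card_lt_card (Finset.ssubset_univ_iff.2 hP')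
    rwa [Finset.card_univ, ZMod.card] at this
  exact absurd (Nat.le_of_dvd hP.card_pos h) (not_le.2 h1)

/-- Properness is essential: the cardinality of the whole of ℤ/nℤ is 0 modulo n, and no point can
follow its translations. -/
theorem barycenter_map_addLeft {P : Finset (ZMod n)} (hP : P.Nonempty) (hP' : P ≠ Finset.univ)
    (a : ZMod n) : barycenter (P.map (Equiv.addLeft a).toEmbedding) = a + barycenter P := by
  have h := card_cast_ne_zero hP hP'
  simp only [barycenter, Finset.card_map, Finset.sum_map, Equiv.coe_toEmbedding,
    Equiv.coe_addLeft]
  rw [Finset.sum_add_distrib, Finset.sum_const, nsmul_eq_mul, mul_add, inv_mul_cancel_left₀ h]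

/-- A choice of an element of each nonempty set of residues, which commutes with translations on
proper subsets. -/
noncomputable def translationChoice (P : Finset (ZMod n)) : ZMod n := by
  -- The copy of `P` recentered at its barycenter depends only on the translation class of a proper
  -- `P`, so an arbitrary choice made there is equivariant.
  classical exact barycenter P +
    if h : (P.map (Equiv.addLeft (-barycenter P)).toEmbedding).Nonempty then h.choose else 0

theorem translationChoice_mem (P : Finset (ZMod n)) (hP : P.Nonempty) :
    translationChoice P ∈ P := by
  have h : (P.map (Equiv.addLeft (-barycenter P)).toEmbedding).Nonempty := hP.map
  have h1 := h.choose_spec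
  rw [translationChoice, dif_pos h]
  obtain ⟨v, hv, hv'⟩ := Finset.mem_map.1 h1
  rw [← hv']
  simpa using hv

theorem translationChoice_map {P : Finset (ZMod n)} (hP : P.Nonempty) (hP' : P ≠ Finset.univ)
    (a : ZMod n) :
    translationChoice (P.map (Equiv.addLeft a).toEmbedding) = a + translationChoice P := by
  have h : (P.map (Equiv.addLeft a).toEmbedding).map
      (Equiv.addLeft (-(a + barycenter P))).toEmbedding =
      P.map (Equiv.addLeft (-barycenter P)).toEmbedding := by
    rw [Finset.map_map]
    congr 1
    ext v
    simp only [Function.Embedding.trans_apply, Equiv.coe_toEmbedding, Equiv.coe_addLeft]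
    ring
  rw [translationChoice, translationChoice, barycenter_map_addLeft hP hP']
  simp only [h, add_assoc]

theorem map_addLeft_ne_univ {P : Finset (ZMod n)} (hP' : P ≠ Finset.univ) (a : ZMod n) :
    P.map (Equiv.addLeft a).toEmbedding ≠ Finset.univ := by
  intro h
  apply hP'
  rw [← Finset.card_eq_iff_eq_univ] at h ⊢
  rwa [Finset.card_map] at h

/-- A translation invariant function sums to a multiple of `n` over the nonempty proper subsets of
`ZMod n`. -/
theorem dvd_sum_of_translation_invariant (F : Finset (ZMod n) → ℤ)
    (hF : ∀ (a : ZMod n) (P : Finset (ZMod n)), P.Nonempty → P ≠ Finset.univ →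
      F (P.map (Equiv.addLeft a).toEmbedding) = F P) :
    (n : ℤ) ∣ ∑ P with P.Nonempty ∧ P ≠ Finset.univ, F P := by
  classical
  rw [← Finset.sum_fiberwise (g := barycenter)]
  -- Translation by `a` carries the sets of barycenter 0 onto those of barycenter `a`, so all n
  -- fibers have the same sum.
  have h : ∀ a : ZMod n,
      ∑ P ∈ Finset.univ.filter (fun P : Finset (ZMod n) => P.Nonempty ∧ P ≠ Finset.univ) with
        barycenter P = a, F P =
      ∑ P ∈ Finset.univ.filter (fun P : Finset (ZMod n) => P.Nonempty ∧ P ≠ Finset.univ) with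
        barycenter P = 0, F P := by
    intro a
    symm
    refine Finset.sum_bij (fun P _ => P.map (Equiv.addLeft a).toEmbedding) ?_ ?_ ?_ ?_
    · intro P hP
      simp only [Finset.mem_filter, Finset.mem_univ, true_and] at hP ⊢
      refine ⟨⟨hP.1.1.map, map_addLeft_ne_univ hP.1.2 a⟩, ?_⟩
      rw [barycenter_map_addLeft hP.1.1 hP.1.2, hP.2, add_zero]
    · intro P _ P' _ h
      exact Finset.map_injective _ h
    · intro P hP
      simp only [Finset.mem_filter, Finset.mem_univ, true_and] at hP
      refine ⟨P.map (Equiv.addLeft (-a)).toEmbedding, ?_, ?_⟩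
      · simp only [Finset.mem_filter, Finset.mem_univ, true_and]
        refine ⟨⟨hP.1.1.map, map_addLeft_ne_univ hP.1.2 _⟩, ?_⟩
        rw [barycenter_map_addLeft hP.1.1 hP.1.2, hP.2, neg_add_cancel]
      · ext v
        simp [Finset.mem_map_equiv]
    · intro P hP
      simp only [Finset.mem_filter, Finset.mem_univ, true_and] at hP
      exact (hF a P hP.1.1 hP.1.2).symm
  rw [Finset.sum_congr rfl fun a _ => h a, Finset.sum_const, Finset.card_univ, ZMod.card,
    nsmul_eq_mul]
  exact Dvd.intro _ rfl

end Translation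

/-! ### Existence of a monochromatic execution, by counting modulo n. -/

namespace AsyncLocal

/-- The indicator function of an event on the outputs. -/
noncomputable def NodeState.indicator {S : Type u} {C : Type} (p : C → Prop) :
    NodeState S C → ℤ := by
  classical exact fun
    | .run _ => 0
    | .term x => if p x then 1 else 0

/-- On a prime number of nodes whose graph is invariant under translation, a coloring algorithm has
an execution that ends with colors which all satisfy `p`, or with colors none of which satisfies
`p`. -/
theorem Algorithm.SolvesColoring.exists_monochromatic {n N : ℕ} [Fact n.Prime] {C : Type}
    {A : Algorithm.{u} C} {G : SimpleGraph (ZMod n)} (hA : A.SolvesColoring G N)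
    (hG : ∀ a v w, G.Adj (a + v) (a + w) ↔ G.Adj v w) (hN : 2 * n - 1 ≤ N) (p : C → Prop) :
    ∃ c : ZMod n → C, (∀ v w, G.Adj v w → c v ≠ c w) ∧ ((∀ v, p (c v)) ∨ ∀ v, ¬ p (c v)) := by
  classical
  by_contra! hcon
  have hn : n.Prime := Fact.out
  let valid : (ZMod n → ℕ) → Prop := fun f =>
    Function.Injective f ∧ ∀ v, f v ∈ Set.Icc 1 N
  let φ : Finset (ZMod n) → (ZMod n → NodeState A.State C) → ℤ := fun S s =>
    ∏ v ∈ S, (s v).indicator p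
  have hφ : ∀ S, DependsOn (φ S) S := fun S s s' h =>
    Finset.prod_congr rfl fun v hv => by rw [h v hv]
  -- Names start at 0 and identifiers at 1, whence the shift. Only the names on `S` are meaningful,
  -- but a run needs valid identifiers everywhere; the choice of extension is irrelevant by
  -- `signedSum_eq_of_agree`. The default 0 is used when there is none.
  let W : Finset (ZMod n) → (ZMod n → ℕ) → ℤ := fun S f =>
    if h : ∃ f', valid f' ∧ ∀ v ∈ S, f' v = f v + 1 then
      hA.signedSum S (φ S) (Reachable.start A G h.choose_spec.1) else 0
  have hWdep : ∀ S, DependsOn (W S) S := by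
    intro S f f' h
    have : (fun g : ZMod n → ℕ => valid g ∧ ∀ v ∈ S, g v = f v + 1) =
        fun g => valid g ∧ ∀ v ∈ S, g v = f' v + 1 := by
      funext g
      refine propext (and_congr_right fun _ => forall₂_congr fun v hv => ?_)
      rw [h v hv]
    simp only [W, this]
  have hW : ∀ S f f' (hf' : valid f'), (∀ v ∈ S, f' v = f v + 1) →
      W S f = hA.signedSum S (φ S) (Reachable.start A G hf') := by
    intro S f f' hf' hff
    have h : ∃ f', valid f' ∧ ∀ v ∈ S, f' v = f v + 1 := ⟨f', hf', hff⟩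
    simp only [W, dif_pos h]
    refine hA.signedSum_eq_of_agree (hφ S) _ _ rfl fun v hv => ?_
    change A.init _ = A.init _
    rw [hff v hv, h.choose_spec.2 v hv]
  -- the terminal configurations are proper colorings
  have hterm : ∀ x : A.Reachable G N, x.1.running Finset.univ = ∅ →
      ∃ c : ZMod n → C, (∀ v, x.1.new v = .term (c v)) ∧ ∀ v w, G.Adj v w → c v ≠ c w := by
    intro x hx
    have h1 : ∀ v, ∃ c, x.1.new v = .term c := by
      intro v
      rcases h : x.1.new v with s | c
      · have : v ∈ x.1.running Finset.univ := Config.mem_running.2 ⟨Finset.mem_univ v, s, h⟩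
        rw [hx] at this
        simp at this
      · exact ⟨c, rfl⟩
    choose c hc using h1
    refine ⟨c, hc, fun v w hvw => ?_⟩
    obtain ⟨ident, hinj, hid, sched, t, ht⟩ := x.2
    exact (hA ident hinj hid sched).2 v w _ _ hvw ⟨t, by rw [ht, hc]⟩ ⟨t, by rw [ht, hc]⟩
  have hzero : ∀ (x : A.Reachable G N), hA.signedSum Finset.univ (fun _ => 0) x = 0 := by
    intro x
    simpa using hA.signedSum_sum (∅ : Finset ℕ) (fun _ => 0) Finset.univ (fun _ _ => 0) x
  have hall : ∀ x : A.Reachable G N, hA.signedSum Finset.univ (φ Finset.univ) x = 0 := by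
    intro x
    rw [hA.signedSum_congr Finset.univ (ψ := fun _ => 0) _ x, hzero]
    intro y hy
    obtain ⟨c, hc, hadj⟩ := hterm y hy
    obtain ⟨v, hv⟩ := (hcon c hadj).1
    exact Finset.prod_eq_zero (Finset.mem_univ v) (by simp [hc, NodeState.indicator, hv])
  have hnone : ∀ x : A.Reachable G N,
      ∑ S : Finset (ZMod n), (-1) ^ S.card * hA.signedSum S (φ S) x = 0 := by
    intro x
    have h1 : ∀ S : Finset (ZMod n), hA.signedSum S (φ S) x =
        hA.signedSum Finset.univ (φ S) x := fun S =>
      (hA.signedSum_eq_of_dependsOn (Finset.subset_univ S) (hφ S) x).symm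
    simp only [h1]
    rw [← hA.signedSum_sum, hA.signedSum_congr Finset.univ (ψ := fun _ => 0) _ x, hzero]
    intro y hy
    obtain ⟨c, hc, hadj⟩ := hterm y hy
    obtain ⟨v, hv⟩ := (hcon c hadj).2
    -- Inclusion-exclusion: the product indicates that no output satisfies `p`.
    have h2 : ∏ v : ZMod n, (1 - (y.1.new v).indicator p) =
        ∑ S : Finset (ZMod n), (-1) ^ S.card * φ S y.1.new := by
      simp only [sub_eq_add_neg, Finset.prod_one_add, Finset.powerset_univ, Finset.prod_neg, φ]
    rw [← h2]
    exact Finset.prod_eq_zero (Finset.mem_univ v) (by simp [hc, NodeState.indicator, hv])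
  let R : Finset (ZMod n) → ((ZMod n → ℕ) → ℤ) → ℤ :=
    nameMeasure translationChoice translationChoice_mem
  have hvalid : ∀ f : ZMod n → ℕ, Set.InjOn f (Finset.univ : Finset (ZMod n)) →
      (∀ v ∈ (Finset.univ : Finset (ZMod n)), f v + 2 ≤ 2 * (Finset.univ : Finset (ZMod n)).card) →
      valid fun v => f v + 1 := by
    intro f hf hle
    refine ⟨fun v w hvw => hf (by simp) (by simp) (by simpa using hvw), fun v => ?_⟩
    have := hle v (Finset.mem_univ v)
    rw [Finset.card_univ, ZMod.card] at this
    exact ⟨Nat.succ_pos _, by dsimp only; omega⟩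
  have hRzero : nameMeasure translationChoice (translationChoice_mem (n := n)) Finset.univ
      (fun _ => 0) = 0 := by
    simpa using nameMeasure_sum (hm := translationChoice_mem (n := n)) (∅ : Finset ℕ)
      (fun _ => 0) Finset.univ (fun _ _ => 0)
  -- Computed over all nodes, `T` permits comparing different `S` on the same executions; computed
  -- over `S` alone, as in `hTS`, it shows the translation symmetry.
  let T : Finset (ZMod n) → ℤ := fun S => R Finset.univ (W S)
  have hTS : ∀ S, T S = R S (W S) := fun S =>
    nameMeasure_eq_of_dependsOn (Finset.subset_univ S) (hWdep S)
  have hsum : ∑ S : Finset (ZMod n), (-1) ^ S.card * T S = 0 := by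
    simp only [T, R]
    rw [← nameMeasure_sum, nameMeasure_congr (h' := fun _ => 0), hRzero]
    intro f hf hle
    rw [← hnone (Reachable.start A G (hvalid f hf hle))]
    refine Finset.sum_congr rfl fun S _ => ?_
    rw [hW S f _ (hvalid f hf hle) fun v _ => rfl]
  have huniv : T Finset.univ = 0 := by
    simp only [T, R]
    rw [nameMeasure_congr (h' := fun _ => 0), hRzero]
    intro f hf hle
    rw [hW _ f _ (hvalid f hf hle) fun v _ => rfl, hall]
  have hempty : T ∅ = 1 := by
    rw [hTS]
    simp only [R]
    have hv : valid fun v : ZMod n => v.val + 1 := by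
      have : NeZero n := ⟨hn.ne_zero⟩
      refine ⟨fun v w hvw => ZMod.val_injective n (by simpa using hvw), fun v => ?_⟩
      have := ZMod.val_lt v
      exact ⟨Nat.succ_pos _, by dsimp only; omega⟩
    rw [nameMeasure_empty, hW ∅ 0 _ hv (by simp),
      hA.signedSum_of_eq_empty _ (Finset.subset_empty.1 (Config.running_subset _ _))]
    simp [φ]
  have hinv : ∀ (a : ZMod n) (S : Finset (ZMod n)), S.Nonempty → S ≠ Finset.univ →
      T (S.map (Equiv.addLeft a).toEmbedding) = T S := by
    intro a S _ hS
    rw [hTS, hTS]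
    simp only [R]
    rw [nameMeasure_map (Equiv.addLeft a) (fun P hP hP' => translationChoice_map hP hP' a) hS]
    refine congrArg _ (funext fun f => ?_)
    let σ : G ≃g G := ⟨Equiv.addLeft a, hG a _ _⟩
    have hmem : ∀ v, a + v ∈ S.map (Equiv.addLeft a).toEmbedding ↔ v ∈ S := fun v =>
      Finset.mem_map' (Equiv.addLeft a).toEmbedding
    have hval : ∀ g, valid g → ∀ b, valid fun v => g (b + v) := fun g hg b =>
      ⟨hg.1.comp (add_right_injective b), fun v => hg.2 _⟩
    -- Valid extensions for `S` translate to valid extensions for its translate and conversely, so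
    -- the default value is taken on both sides or on neither.
    by_cases h : ∃ g, valid g ∧ ∀ v ∈ S, g v = f v + 1
    · obtain ⟨g, hg, hgf⟩ := h
      have hg' := hval g hg (-a)
      rw [hW S f g hg hgf, hW _ _ _ hg']
      · have := hA.signedSum_map σ S (φ (S.map (Equiv.addLeft a).toEmbedding))
          (Reachable.start A G hg) (Reachable.start A G hg') (fun v => rfl) (fun v => by
            change A.init (g (-a + (a + v))) = A.init (g v)
            rw [neg_add_cancel_left])
        refine this.trans (congrFun (congrArg _ (funext fun s => ?_)) _)
        simp only [φ, Finset.prod_map]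
        refine Finset.prod_congr rfl fun v _ => ?_
        exact congrArg (fun w => (s w).indicator p) (σ.symm_apply_apply v)
      · intro v hv
        obtain ⟨w, hw, rfl⟩ := Finset.mem_map.1 hv
        simp [hgf w hw]
    · have h' : ¬ ∃ g, valid g ∧ ∀ v ∈ S.map (Equiv.addLeft a).toEmbedding,
          g v = (f ∘ (Equiv.addLeft a).symm) v + 1 := by
        rintro ⟨g, hg, hgf⟩
        refine h ⟨fun v => g (a + v), hval g hg a, fun v hv => ?_⟩
        have := hgf _ ((hmem v).2 hv)
        dsimp only
        rw [this]
        simp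
      simp only [W]
      rw [dif_neg h, dif_neg h']
  have hdvd := dvd_sum_of_translation_invariant (fun S => (-1) ^ S.card * T S)
    fun a S hS hS' => by rw [Finset.card_map, hinv a S hS hS']
  have hne : (∅ : Finset (ZMod n)) ≠ Finset.univ := Finset.univ_nonempty.ne_empty.symm
  have hsplit : (Finset.univ : Finset (Finset (ZMod n))) =
      insert ∅ (insert Finset.univ
        (Finset.univ.filter fun P : Finset (ZMod n) => P.Nonempty ∧ P ≠ Finset.univ)) := by
    ext P
    simp only [Finset.mem_univ, Finset.mem_insert, Finset.mem_filter, true_and, true_iff]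
    rcases P.eq_empty_or_nonempty with h | h
    · exact Or.inl h
    · by_cases h' : P = Finset.univ
      · exact Or.inr (Or.inl h')
      · exact Or.inr (Or.inr ⟨h, h'⟩)
  -- The alternating sum becomes 1 + 0 + (a multiple of n) = 0.
  rw [hsplit, Finset.sum_insert (by simpa using hne), Finset.sum_insert (by simp), huniv,
    hempty] at hsum
  have h1 : (n : ℤ) ∣ 1 := by
    rw [Finset.card_empty, pow_zero, mul_one, mul_zero, zero_add] at hsum
    rw [eq_neg_of_add_eq_zero_left hsum]
    exact hdvd.neg_right
  exact hn.one_lt.ne' (by exact_mod_cast Int.eq_one_of_dvd_one (by positivity) h1)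

/-! ### Colorability and regularity of the circulant graph. -/

section RingGraph

theorem ringGraph_adj {n k : ℕ} {v w : ZMod n} : (ringGraph n k).Adj v w ↔
    v ≠ w ∧ ∃ j ∈ Set.Icc 1 k, w = v + (j : ZMod n) ∨ v = w + (j : ZMod n) := by
  simp only [ringGraph, SimpleGraph.circulantGraph_adj]
  refine and_congr_right fun _ => ?_
  constructor
  · rintro (⟨j, hj, h⟩ | ⟨j, hj, h⟩)
    · exact ⟨j, hj, Or.inr (by linear_combination -h)⟩
    · exact ⟨j, hj, Or.inl (by linear_combination -h)⟩
  · rintro ⟨j, hj, h | h⟩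
    · exact Or.inr ⟨j, hj, by linear_combination -h⟩
    · exact Or.inl ⟨j, hj, by linear_combination -h⟩

theorem natCast_eq_iff {n a b : ℕ} (ha : a < n) (hb : b < n) :
    (a : ZMod n) = (b : ZMod n) ↔ a = b := by
  rw [ZMod.natCast_eq_natCast_iff', Nat.mod_eq_of_lt ha, Nat.mod_eq_of_lt hb]

theorem ringGraph_adj_add {n k i j : ℕ} (hkn : k < n) (v : ZMod n) (hij : i < j)
    (hjk : j ≤ i + k) : (ringGraph n k).Adj (v + i) (v + j) := by
  have h : (j : ZMod n) = i + ((j - i : ℕ) : ZMod n) := by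
    rw [← Nat.cast_add]; congr 1; omega
  rw [ringGraph_adj, h, ← add_assoc]
  refine ⟨fun h0 => ?_, j - i, ⟨by omega, by omega⟩, Or.inl rfl⟩
  have h1 : ((j - i : ℕ) : ZMod n) = ((0 : ℕ) : ZMod n) := by
    rw [Nat.cast_zero]
    exact left_eq_add.1 h0
  rw [natCast_eq_iff (by omega) (by omega)] at h1
  omega

/-- The circulant graph cannot be colored with `k + 1` colors, since the coloring would have period
`k + 1`. -/
theorem ringGraph_not_colorable {n k : ℕ} [Fact n.Prime] (hk : 0 < k) (hkn : k + 1 < n)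
    {C : Type} [DecidableEq C] (c : ZMod n → C)
    (hc : ∀ v w, (ringGraph n k).Adj v w → c v ≠ c w) (s : Finset C) (hs : s.card ≤ k + 1)
    (hcs : ∀ v, c v ∈ s) : False := by
  have hper : ∀ v, c (v + (k + 1 : ℕ)) = c v := by
    intro v
    by_contra hne
    -- Among `v, …, v + (k+1)` the two ends are the only pair not joined by construction; if their
    -- colors differed too, k+2 colors would occur.
    have hinj : Set.InjOn (fun i : ℕ => c (v + i)) (Finset.range (k + 2)) := by
      have key : ∀ i j : ℕ, i < j → j < k + 2 → c (v + i) ≠ c (v + j) := by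
        intro i j hij hj
        by_cases h : j ≤ i + k
        · exact hc _ _ (ringGraph_adj_add (by omega) v hij h)
        · obtain ⟨rfl, rfl⟩ : i = 0 ∧ j = k + 1 := by omega
          simpa using Ne.symm hne
      intro i hi j hj h
      simp only [Finset.coe_range, Set.mem_Iio] at hi hj
      rcases lt_trichotomy i j with hij | hij | hij
      · exact absurd h (key i j hij hj)
      · exact hij
      · exact absurd h.symm (key j i hij hi)
    have := Finset.card_le_card_of_injOn _ (fun i _ => hcs (v + (i : ℕ))) hinj
    rw [Finset.card_range] at this
    omega
  have hmul : ∀ (j : ℕ) v, c (v + (j * (k + 1) : ℕ)) = c v := by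
    intro j
    induction j with
    | zero => simp
    | succ j ih =>
      intro v
      rw [show v + (((j + 1) * (k + 1) : ℕ) : ZMod n) =
        v + (j * (k + 1) : ℕ) + (k + 1 : ℕ) by push_cast; ring, hper, ih]
  have hunit : ((k + 1 : ℕ) : ZMod n) ≠ 0 := by
    rw [← Nat.cast_zero, Ne, natCast_eq_iff hkn (by omega)]
    omega
  have h1 := hmul (((k + 1 : ℕ) : ZMod n)⁻¹).val 0
  have : NeZero n := ⟨by omega⟩
  rw [Nat.cast_mul, ZMod.natCast_zmod_val, inv_mul_cancel₀ hunit] at h1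
  refine hc 0 (0 + 1) ?_ h1.symm
  simpa using ringGraph_adj_add (n := n) (k := k) (i := 0) (j := 1) (by omega) 0 (by omega)
    (by omega)

/-- The event `x.1 < k + 1` cuts the palette into two halves of k+1 colors, each too small to color
the graph. -/
theorem ringGraph_not_solvesColoring {n k N : ℕ} [Fact n.Prime] (hk : 0 < k) (hkn : k + 1 < n)
    (hN : 2 * n - 1 ≤ N) (A : Algorithm.{u} (Fin (2 * k + 2))) :
    ¬ A.SolvesColoring (ringGraph n k) N := by
  intro hA
  obtain ⟨c, hc, h⟩ := hA.exists_monochromatic (fun a v w => by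
    simp only [ringGraph_adj, add_assoc, ne_eq, add_right_inj]) hN fun x => x.1 < k + 1
  have hcard : (Finset.univ.filter fun x : Fin (2 * k + 2) => x.1 < k + 1).card = k + 1 := by
    rw [Fin.card_filter_val_lt]
    omega
  rcases h with h | h
  · exact ringGraph_not_colorable hk hkn c hc
      (Finset.univ.filter fun x : Fin (2 * k + 2) => x.1 < k + 1) hcard.le (by simpa using h)
  · refine ringGraph_not_colorable hk hkn c hc
      (Finset.univ.filter fun x : Fin (2 * k + 2) => ¬ x.1 < k + 1) ?_ (by simpa using h)
    have := Finset.card_filter_add_card_filter_not (s := (Finset.univ : Finset (Fin (2 * k + 2))))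
      (fun x : Fin (2 * k + 2) => x.1 < k + 1)
    rw [hcard, Finset.card_univ, Fintype.card_fin] at this
    omega

theorem ringGraph_connected {n k : ℕ} [NeZero n] (hk : 0 < k) (hkn : k < n) :
    (ringGraph n k).Connected := by
  have h : ∀ i : ℕ, (ringGraph n k).Reachable 0 (i : ZMod n) := by
    intro i
    induction i with
    | zero => simp
    | succ i ih =>
      refine ih.trans (SimpleGraph.Adj.reachable ?_)
      simpa using ringGraph_adj_add hkn (0 : ZMod n) (Nat.lt_succ_self i)
        (show i + 1 ≤ i + k by omega)
  have h' : ∀ v : ZMod n, (ringGraph n k).Reachable 0 v := fun v => by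
    simpa using h v.val
  exact ⟨fun v w => (h' v).symm.trans (h' w)⟩

theorem ringGraph_ncard_neighborSet {n k : ℕ} (hkn : 2 * k < n) (v : ZMod n) :
    ((ringGraph n k).neighborSet v).ncard = 2 * k := by
  classical
  have h : (ringGraph n k).neighborSet v =
      ((Finset.Icc 1 k ∪ Finset.Ico (n - k) n).image fun j : ℕ => v + (j : ZMod n) :
        Finset (ZMod n)) := by
    ext w
    simp only [SimpleGraph.mem_neighborSet, ringGraph_adj, Finset.coe_image, Set.mem_image,
      Finset.mem_coe, Finset.mem_union, Finset.mem_Icc, Finset.mem_Ico]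
    constructor
    · rintro ⟨-, j, ⟨h1, h2⟩, rfl | rfl⟩
      · exact ⟨j, Or.inl ⟨h1, h2⟩, rfl⟩
      · refine ⟨n - j, Or.inr ⟨by omega, by omega⟩, ?_⟩
        rw [Nat.cast_sub (by omega), ZMod.natCast_self]
        ring
    · rintro ⟨j, hj, rfl⟩
      refine ⟨fun h0 => ?_, ?_⟩
      · have h1 : ((j : ℕ) : ZMod n) = ((0 : ℕ) : ZMod n) := by
          rw [Nat.cast_zero]
          exact left_eq_add.1 h0
        rw [natCast_eq_iff (by omega) (by omega)] at h1
        omega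
      · rcases hj with hj | hj
        · exact ⟨j, hj, Or.inl rfl⟩
        · refine ⟨n - j, ⟨by omega, by omega⟩, Or.inr ?_⟩
          rw [Nat.cast_sub (by omega), ZMod.natCast_self]
          ring
  rw [h, Set.ncard_coe_finset, Finset.card_image_of_injOn, Finset.card_union_of_disjoint,
    Nat.card_Icc, Nat.card_Ico]
  · omega
  · rw [Finset.disjoint_left]
    intro j hj hj'
    rw [Finset.mem_Icc] at hj
    rw [Finset.mem_Ico] at hj'
    omega
  · intro i hi j hj hij
    simp only [Finset.coe_union, Set.mem_union, Finset.mem_coe, Finset.mem_Icc,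
      Finset.mem_Ico] at hi hj
    exact (natCast_eq_iff (by omega) (by omega)).1 (add_left_cancel hij)

end RingGraph

end AsyncLocal

theorem corollary7 (Δ n N : ℕ) [Fact n.Prime] (hΔ : Even Δ) (hΔ0 : 0 < Δ) (hn : Δ < n)
    (hN : 2 * n - 1 ≤ N) :
    (¬ ∃ A : AsyncLocal.Algorithm.{u} (Fin (Δ + 2)),
      A.SolvesColoring (AsyncLocal.ringGraph n (Δ / 2)) N) ∧
    (¬ ∃ A : AsyncLocal.Algorithm.{u} (Fin (Δ + 2)),
      ∀ G : SimpleGraph (Fin n), G.Connected → (∀ v, (G.neighborSet v).ncard = Δ) →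
        A.SolvesColoring G N) := by
  obtain ⟨k, rfl⟩ := hΔ
  rw [← two_mul, Nat.mul_div_cancel_left k two_pos]
  have hmain := AsyncLocal.ringGraph_not_solvesColoring.{u} (n := n) (k := k) (by omega)
    (by omega) hN
  refine ⟨fun ⟨A, hA⟩ => hmain A hA, fun ⟨A, hA⟩ => hmain A ?_⟩
  -- For a successor, `ZMod (m + 1)` is `Fin (m + 1)` by definition, so the circulant graph is an
  -- instance of the second part.
  obtain ⟨m, rfl⟩ : ∃ m, n = m + 1 := ⟨n - 1, by omega⟩
  have h : ∀ v : ZMod (m + 1), ((AsyncLocal.ringGraph (m + 1) k).neighborSet v).ncard = 2 * k :=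
    AsyncLocal.ringGraph_ncard_neighborSet (by omega)
  exact hA (AsyncLocal.ringGraph (m + 1) k)
    (AsyncLocal.ringGraph_connected (n := m + 1) (by omega) (by omega)) h
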